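/- Let $(R,\mathfrak m)$ be a Noetherian local ring, $M$ a finitely generated $R$-module with $\dim M=2$ and $\operatorname{depth} M>0$, and $\mathfrak q$ an $\mathfrak m$-primary ideal. Let $\mathbb M=\{M_n\}_{n\ge 0}$ be a good $\mathfrak q$-filtration of $M$: submodules $M=M_0\supseteq M_1\supseteq\cdots$ with $\mathfrak q M_n\subseteq M_{n+1}$ for all $n$ and $\mathfrak q M_n=M_{n+1}$ for all large $n$. For a good $\mathfrak q$-filtration $\mathbb F=\{F_n\}$ of $M$, let $H_{\mathbb F}(n)=\lambda(F_n/F_{n+1})$ for $n\ge 0$ ($\lambda$ is length) and $H_{\mathbb F}(n)=0$ for $n<0$; let $h_{\mathbb F}\in\mathbb Z[t]$ be the polynomial with $\sum_{n\ge 0}H_{\mathbb F}(n)t^n=h_{\mathbb F}(t)/(1-t)^2$ and $h_{\mathbb F}(1)\neq 0$; let $e_i(\mathbb F)=h_{\mathbb F}^{(i)}(1)/i!$ and $p_{\mathbb F}(n)=e_0(\mathbb F)(n+1)-e_1(\mathbb F)$. The postulation number of $\mathbb F$ is the largest integer $n$ with $H_{\mathbb F}(n)\ne p_{\mathbb F}(n)$.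 The Ratliff–Rush filtration associated to $\mathbb M$ is $\widetilde{\mathbb M}=\{\widetilde M_n\}$, $\widetilde M_n=\bigcup_{k\ge 1}(M_{n+k}:_M\mathfrak q^k)$. An element $a\in\mathfrak q$ is superficial for a $\mathfrak q$-filtration $\{N_n\}$ of a module $N$ if there is $c\ge 0$ with $(N_{n+1}:_N a)\cap N_c=N_n$ for all $n\ge c$. Suppose that $a_1,a_2$ is a (maximal) $\mathbb M$-superficial sequence for $\mathfrak q$, i.e. $a_1$ is superficial for $\mathbb M$ and $a_2$ is superficial for the filtration $\{(M_n+a_1M)/a_1M\}$ of $M/a_1M$. Then the polynomials $h_{\mathbb M}$ and $h_{\widetilde{\mathbb M}}$ and the postulation number $s$ of $\widetilde{\mathbb M}$ exist, $\lambda\big((a_1M:_M a_2)/a_1M\big)$ is finite, and $$e_2(\mathbb M)\ \ge\ -\binom{s+2}{2}\,\lambda\!\left(\frac{a_1M:_M a_2}{a_1M}\right).$$ -/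

import Mathlib

open Polynomial
open scoped Pointwise

namespace HilbertFiltration

variable {R : Type*} [CommRing R] {M : Type*} [AddCommGroup M] [Module R M]

section ModuleNotions

variable (R M)

/-- The Krull dimension of a (nonzero, finite-dimensional) module, as a natural number. -/
noncomputable def dimNat : ℕ := ((Module.supportDim R M).unbotD 0).toNat

/-- The depth of a module over a local ring: the supremum of the lengths of the `M`-regular
sequences contained in the maximal ideal. -/
noncomputable def depth [IsLocalRing R] : ℕ∞ :=
  ⨆ (rs : List R) (_ : ∀ r ∈ rs, r ∈ IsLocalRing.maximalIdeal R)
    (_ : RingTheory.Sequence.IsRegular M rs), (rs.length : ℕ∞)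

end ModuleNotions

/-- `N :_M a`, the submodule of all `x : M` with `a • x ∈ N`. -/
def colonElem (N : Submodule R M) (a : R) : Submodule R M :=
  N.comap (LinearMap.lsmul R M a)

/-- `N :_M I`, the submodule of all `x : M` with `I x ⊆ N`. -/
def colonIdeal (N : Submodule R M) (I : Ideal R) : Submodule R M where
  carrier := {x | ∀ r ∈ I, r • x ∈ N}
  add_mem' := fun hx hy r hr => by
    rw [smul_add]; exact N.add_mem (hx r hr) (hy r hr)
  zero_mem' := fun r _ => by rw [smul_zero]; exact N.zero_mem
  smul_mem' := fun c x hx r hr => by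
    rw [smul_comm]; exact N.smul_mem c (hx r hr)

/-- The length of the subquotient `A / B` for submodules `B ≤ A` of `M`. -/
noncomputable def lengthQuot (A B : Submodule R M) : ℕ∞ :=
  Module.length R (A ⧸ B.submoduleOf A)

variable {q : Ideal R}

/-- A good `q`-filtration `M = M_0 ⊇ M_1 ⊇ ⋯`: `q M_n ⊆ M_{n+1}` for all `n`, with equality for
all large `n`. -/
structure IsGood (F : q.Filtration M) : Prop where
  zero : F.N 0 = ⊤
  stable : F.Stable

/-- The filtration `{(M_n + N) / N}` induced on the quotient `M / N`. -/
def quotFiltration (F : q.Filtration M) (N : Submodule R M) : q.Filtration (M ⧸ N) where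
  N n := (F.N n).map N.mkQ
  mono n := Submodule.map_mono (F.mono n)
  smul_le n := by
    rw [← Submodule.map_smul'']
    exact Submodule.map_mono (F.smul_le n)

/-- `a` is an `F`-superficial element for `q`: `a ∈ q` and there is `c` such that
`(M_{n+1} :_M a) ∩ M_c = M_n` for all `n ≥ c`. -/
def IsSuperficial (F : q.Filtration M) (a : R) : Prop :=
  a ∈ q ∧ ∃ c : ℕ, ∀ n : ℕ, c ≤ n → colonElem (F.N (n + 1)) a ⊓ F.N c = F.N n

/-- `a_1, …, a_r` is an `F`-superficial sequence for `q`: each `a_i` is superficial for the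
filtration induced on `M / (a_1, …, a_{i-1}) M`. -/
def IsSuperficialSeq (F : q.Filtration M) (as : List R) : Prop :=
  ∀ (i : ℕ) (hi : i < as.length),
    IsSuperficial (quotFiltration F (Ideal.ofList (as.take i) • (⊤ : Submodule R M))) as[i]

/-- A superficial sequence is maximal when its length is the dimension of `M`. -/
def IsMaximalSuperficialSeq (F : q.Filtration M) (as : List R) : Prop :=
  IsSuperficialSeq F as ∧ as.length = dimNat R M

/-- The Hilbert function `H(n) = λ(M_n / M_{n+1})`. -/
noncomputable def hilbertFunction (F : q.Filtration M) (n : ℕ) : ℕ :=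
  (lengthQuot (F.N n) (F.N (n + 1))).toNat

/-- The Hilbert function on all integers (`gr(M)` vanishes in negative degrees). -/
noncomputable def hilbertFunctionInt (F : q.Filtration M) (n : ℤ) : ℤ :=
  if 0 ≤ n then (hilbertFunction F n.toNat : ℤ) else 0

/-- The Hilbert series `P(t) = ∑ H(n) t^n`. -/
noncomputable def hilbertSeries (F : q.Filtration M) : PowerSeries ℤ :=
  PowerSeries.mk fun n => (hilbertFunction F n : ℤ)

/-- `h` is the `h`-polynomial of the filtration: `P(t) (1 - t)^d = h(t)` with `d = dim M`, and
`h(1) ≠ 0`. -/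
def IsHPolynomial (F : q.Filtration M) (h : ℤ[X]) : Prop :=
  hilbertSeries F * (1 - PowerSeries.X) ^ dimNat R M = (h : PowerSeries ℤ) ∧ h.eval 1 ≠ 0

open Classical in
/-- The `h`-polynomial of the filtration (unique when it exists; `0` otherwise). -/
noncomputable def hPolynomial (F : q.Filtration M) : ℤ[X] :=
  if hF : ∃ h : ℤ[X], IsHPolynomial F h then hF.choose else 0

/-- The Hilbert coefficients `e_i = h^{(i)}(1) / i!`; the Hasse derivative is the `i`-th
derivative divided by `i!`. -/
noncomputable def hilbertCoeff (F : q.Filtration M) (i : ℕ) : ℤ :=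
  (Polynomial.hasseDeriv i (hPolynomial F)).eval 1

/-- The value at `n` of the Hilbert polynomial
`p(n) = ∑_{i=0}^{d-1} (-1)^i e_i binom(n + d - i - 1, d - i - 1)`; here `Ring.choose x k` is the
polynomial binomial `x (x - 1) ⋯ (x - k + 1) / k!`, also for negative `x`. -/
noncomputable def hilbertPolynomialVal (F : q.Filtration M) (n : ℤ) : ℤ :=
  ∑ i ∈ Finset.range (dimNat R M),
    (-1) ^ i * hilbertCoeff F i *
      Ring.choose (n + ((dimNat R M - i - 1 : ℕ) : ℤ)) (dimNat R M - i - 1)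

/-- `s` is the postulation number: the largest integer `n` with `H(n) ≠ p(n)`. -/
def IsPostulationNumber (F : q.Filtration M) (s : ℤ) : Prop :=
  IsGreatest {n : ℤ | hilbertFunctionInt F n ≠ hilbertPolynomialVal F n} s

/-- The Ratliff–Rush filtration associated to `F`:
its `n`-th term is `⋃_{k ≥ 1} (M_{n+k} :_M q^k)`. -/
def ratliffRush (F : q.Filtration M) : q.Filtration M where
  N n :=
    { carrier := ⋃ k ≥ 1, (colonIdeal (F.N (n + k)) (q ^ k) : Set M)
      add_mem' := by
        have key : ∀ {x : M} {k l : ℕ}, k ≤ l → x ∈ colonIdeal (F.N (n + k)) (q ^ k) →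
            x ∈ colonIdeal (F.N (n + l)) (q ^ l) := by
          intro x k l hkl hx r hr
          obtain ⟨j, rfl⟩ := Nat.exists_eq_add_of_le' hkl
          rw [pow_add] at hr
          refine Submodule.mul_induction_on hr ?_ ?_
          · intro a ha b hb
            rw [mul_smul]
            have := F.pow_smul_le j (n + k) (Submodule.smul_mem_smul ha (hx b hb))
            rwa [show j + (n + k) = n + (j + k) by omega] at this
          · intro a b ha hb
            rw [add_smul]; exact Submodule.add_mem _ ha hb
        intro x y hx hy
        simp only [Set.mem_iUnion, SetLike.mem_coe] at hx hy ⊢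
        obtain ⟨k, hk, hx⟩ := hx
        obtain ⟨l, hl, hy⟩ := hy
        exact ⟨max k l, le_max_of_le_left hk, Submodule.add_mem _
          (key (le_max_left k l) hx) (key (le_max_right k l) hy)⟩
      zero_mem' := by
        simp only [Set.mem_iUnion, SetLike.mem_coe]
        exact ⟨1, le_rfl, Submodule.zero_mem _⟩
      smul_mem' := by
        intro c x hx
        simp only [Set.mem_iUnion, SetLike.mem_coe] at hx ⊢
        obtain ⟨k, hk, hx⟩ := hx
        exact ⟨k, hk, Submodule.smul_mem _ c hx⟩ }
  mono n := by
    intro x hx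
    simp only [Submodule.mem_mk, AddSubmonoid.mem_mk, AddSubsemigroup.mem_mk,
      Set.mem_iUnion, SetLike.mem_coe] at hx ⊢
    obtain ⟨k, hk, hx⟩ := hx
    exact ⟨k, hk, fun r hr => F.antitone (by omega) (hx r hr)⟩
  smul_le n := by
    rw [Submodule.smul_le]
    intro a ha x hx
    simp only [Submodule.mem_mk, AddSubmonoid.mem_mk, AddSubsemigroup.mem_mk,
      Set.mem_iUnion, SetLike.mem_coe] at hx ⊢
    obtain ⟨k, hk, hx⟩ := hx
    refine ⟨k, hk, fun r hr => ?_⟩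
    rw [smul_comm]
    have := F.smul_le _ (Submodule.smul_mem_smul ha (hx r hr))
    rwa [show n + k + 1 = n + 1 + k by omega] at this

end HilbertFiltration

/-! Depth makes `a₁` regular on `M`, so `(M_{n+1} : a₁) = M_n` for large `n`. The Ratliff–Rush
filtration `Ft` agrees with `F` in large degrees and satisfies this colon identity in every degree
(`ratliffRush_eq_of_colonElem_eq`, `colonElem_ratliffRush`). Hence its Hilbert function at `n` is
exactly `g (n + 1)`, where `g n` is the colength of the image of `Ft_n` in `N = M / a₁M`.
Multiplication by `a₂` on the one-dimensional module `N` shows that `g` never jumps by more than `u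
= λ(N / a₂N)` and eventually jumps by exactly `u - l = e₀`, where `l = λ(0 :_N a₂)`
(`colength_succ_le`, `IsSuperficial.exists_colength_succ_add_eq`). So the deviation `D(n) = H(n) -
p(n)` of `Ft` has jumps at most `l` and vanishes beyond `s`, which gives `D(s + 1 - j) ≥ -j l`.
Finally, `e₂` is the total deviation over `n ≥ 0`. Partial sums of a Hilbert function are colengths,
so `F` and `Ft` have the same `e₂`; summing the bounds on `D` yields `-binom(s + 2, 2) l`. -/

namespace HilbertFiltration

/-! ### Lengths of quotients and colon submodules. -/

section Length

variable {R : Type*} [CommRing R] {M : Type*} [AddCommGroup M] [Module R M]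

theorem mem_colonElem {N : Submodule R M} {a : R} {x : M} : x ∈ colonElem N a ↔ a • x ∈ N :=
  Iff.rfl

theorem mapQ_injective_of_eq_comap {M' : Type*} [AddCommGroup M'] [Module R M']
    {P : Submodule R M} {P' : Submodule R M'} {f : M →ₗ[R] M'} (h : P = P'.comap f) :
    Function.Injective (P.mapQ P' f h.le) := by
  subst h
  rw [← LinearMap.ker_eq_bot, Submodule.ker_mapQ]
  exact Submodule.mkQ_map_self _

theorem length_quotient_eq_lengthQuot_add {A B : Submodule R M} (h : B ≤ A) :
    Module.length R (M ⧸ B) = lengthQuot A B + Module.length R (M ⧸ A) := by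
  refine Module.length_eq_add_of_exact
    (Submodule.mapQ (B.submoduleOf A) B A.subtype le_rfl) (Submodule.factor h) ?_
    (Submodule.factor_surjective h) ?_
  · exact mapQ_injective_of_eq_comap rfl
  · intro y
    obtain ⟨x, rfl⟩ := B.mkQ_surjective y
    constructor
    · intro hx
      have : x ∈ A := by simpa using hx
      exact ⟨Submodule.Quotient.mk ⟨x, this⟩, rfl⟩
    · rintro ⟨z, hz⟩
      obtain ⟨z, rfl⟩ := Submodule.mkQ_surjective _ z
      rw [← hz]
      exact (Submodule.Quotient.mk_eq_zero A).mpr z.2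

/-- Additivity along `0 → M/(B : a) → M/B → M/(B + aM) → 0`, the first map being multiplication by
`a`. Every comparison of Hilbert functions with colengths modulo an element rests on it. -/
theorem length_quotient_eq_colonElem_add (B : Submodule R M) (a : R) :
    Module.length R (M ⧸ B) = Module.length R (M ⧸ colonElem B a) +
      Module.length R (M ⧸ (B ⊔ a • (⊤ : Submodule R M))) := by
  refine Module.length_eq_add_of_exact
    (Submodule.mapQ (colonElem B a) B (LinearMap.lsmul R M a) le_rfl)
    (Submodule.factor le_sup_left) ?_ (Submodule.factor_surjective _) ?_
  · exact mapQ_injective_of_eq_comap rfl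
  · intro y
    obtain ⟨x, rfl⟩ := B.mkQ_surjective y
    constructor
    · intro hx
      have : x ∈ B ⊔ a • (⊤ : Submodule R M) := by simpa using hx
      obtain ⟨b, hb, z, hz, rfl⟩ := Submodule.mem_sup.mp this
      obtain ⟨w, -, rfl⟩ := (Submodule.mem_smul_pointwise_iff_exists _ _ _).mp hz
      refine ⟨Submodule.Quotient.mk w, ?_⟩
      refine (Submodule.Quotient.eq B).mpr ?_
      simpa using hb
    · rintro ⟨z, hz⟩
      obtain ⟨z, rfl⟩ := Submodule.mkQ_surjective _ z
      rw [← hz]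
      exact (Submodule.Quotient.mk_eq_zero _).mpr
        (Submodule.mem_sup_right (Submodule.smul_mem_pointwise_smul z a ⊤ trivial))

theorem lengthQuot_sup_eq_length {A K : Submodule R M} (h : A ⊓ K = ⊥) :
    lengthQuot (A ⊔ K) A = Module.length R K := by
  rw [sup_comm]
  refine (LinearMap.quotientInfEquivSupQuotient K A).length_eq.symm.trans ?_
  refine (Submodule.quotEquivOfEqBot _ ?_).length_eq
  rw [← Submodule.comap_inf, inf_comm, h]
  simp

theorem length_quotient_map_mkQ (P B : Submodule R M) :
    Module.length R ((M ⧸ P) ⧸ B.map P.mkQ) = Module.length R (M ⧸ (B ⊔ P)) := by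
  rw [sup_comm]
  exact (Submodule.quotientQuotientEquivQuotientSup P B).length_eq

/-- Translates the length in the final bound into the annihilator of `a₂` in `M / a₁M`, the form in
which it enters the growth count there. -/
theorem lengthQuot_colonElem_eq_length_ker (P : Submodule R M) (a : R) :
    lengthQuot (colonElem P a) P = Module.length R (LinearMap.ker (LinearMap.lsmul R (M ⧸ P) a)) := by
  let f : (colonElem P a ⧸ P.submoduleOf (colonElem P a)) →ₗ[R] (M ⧸ P) :=
    Submodule.mapQ _ P (colonElem P a).subtype le_rfl
  have hf : Function.Injective f := mapQ_injective_of_eq_comap rfl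
  have hr : LinearMap.range f = LinearMap.ker (LinearMap.lsmul R (M ⧸ P) a) := by
    ext y
    obtain ⟨x, rfl⟩ := P.mkQ_surjective y
    constructor
    · rintro ⟨z, hz⟩
      obtain ⟨⟨z, hz'⟩, rfl⟩ := Submodule.mkQ_surjective _ z
      rw [← hz]
      rw [LinearMap.mem_ker]
      exact (Submodule.Quotient.mk_eq_zero P).mpr hz'
    · intro hx
      have : x ∈ colonElem P a := (Submodule.Quotient.mk_eq_zero P).mp hx
      exact ⟨Submodule.Quotient.mk ⟨x, this⟩, rfl⟩
  rw [← hr]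
  exact (LinearEquiv.ofInjective f hf).length_eq

end Length

/-! ### Finite length and dimension zero over a Noetherian local ring. -/

section Local

variable {R : Type*} [CommRing R] [IsNoetherianRing R] {M : Type*} [AddCommGroup M] [Module R M]
  [Module.Finite R M]

theorem isFiniteLength_of_supportDim_le_zero (h : Module.supportDim R M ≤ 0) :
    IsFiniteLength R M := by
  rw [Module.supportDim_eq_ringKrullDim_quotient_annihilator] at h
  have : Ring.KrullDimLE 0 (R ⧸ Module.annihilator R M) :=
    Ring.krullDimLE_iff.mpr (by simpa using h)
  have : IsArtinianRing (R ⧸ Module.annihilator R M) :=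
    isArtinianRing_iff_krullDimLE_zero.mpr this
  let _ : Module (R ⧸ Module.annihilator R M) M := Module.quotientAnnihilator
  have : IsScalarTower R (R ⧸ Module.annihilator R M) M :=
    Module.IsTorsionBySet.isScalarTower (Module.isTorsionBySet_annihilator R M)
  have : Module.Finite (R ⧸ Module.annihilator R M) M := Module.Finite.of_restrictScalars_finite R _ M
  rw [← Module.length_ne_top_iff, Module.length_eq_of_surjective (S := R)
    (R := R ⧸ Module.annihilator R M) (M := M) Ideal.Quotient.mk_surjective]
  exact Module.length_ne_top

variable [IsLocalRing R]

omit [IsNoetherianRing R] in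
theorem supportDim_le_zero_of_pow_le_annihilator {k : ℕ}
    (h : IsLocalRing.maximalIdeal R ^ k ≤ Module.annihilator R M) :
    Module.supportDim R M ≤ 0 := by
  have hs : Subsingleton (Module.support R M) := by
    refine ⟨fun p p' => Subtype.ext ?_⟩
    have key : ∀ p : Module.support R M, p.1 = IsLocalRing.closedPoint R := by
      rintro ⟨p, hp⟩
      have h1 : Module.annihilator R M ≤ p.asIdeal := by
        rw [Module.support_eq_zeroLocus] at hp
        exact hp
      have h2 := p.2.le_of_pow_le (h.trans h1)
      exact PrimeSpectrum.ext ((IsLocalRing.maximalIdeal.isMaximal R).eq_of_le p.2.ne_top h2).symm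
    rw [key, key]
  exact Order.krullDim_nonpos_of_subsingleton

variable {q : Ideal R}

/-- The chain `q ^ n M` stabilizes by the Artinian property, and its intersection is zero by Krull.
-/
theorem exists_pow_smul_top_eq_bot (hq : q ≠ ⊤) (h : IsFiniteLength R M) :
    ∃ k : ℕ, q ^ k • (⊤ : Submodule R M) = ⊥ := by
  have := (isFiniteLength_iff_isNoetherian_isArtinian.mp h).2
  obtain ⟨k, hk⟩ := IsArtinian.monotone_stabilizes (R := R) (M := M)
    ⟨fun n => OrderDual.toDual (q ^ n • (⊤ : Submodule R M)), fun m n hmn =>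
      Submodule.smul_mono_left (Ideal.pow_le_pow_right hmn)⟩
  refine ⟨k, ?_⟩
  rw [← Ideal.iInf_pow_smul_eq_bot_of_isLocalRing (M := M) q hq]
  refine le_antisymm (le_iInf fun n => ?_) (iInf_le _ k)
  rcases le_total k n with hn | hn
  · exact (congrArg OrderDual.ofDual (hk n hn)).le
  · exact Submodule.smul_mono_left (Ideal.pow_le_pow_right hn)

theorem supportDim_le_zero_of_isFiniteLength (h : IsFiniteLength R M) :
    Module.supportDim R M ≤ 0 := by
  obtain ⟨k, hk⟩ := exists_pow_smul_top_eq_bot (q := IsLocalRing.maximalIdeal R)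
    Ideal.IsPrime.ne_top' h
  refine supportDim_le_zero_of_pow_le_annihilator (k := k) fun r hr => ?_
  rw [Module.mem_annihilator]
  intro x
  have := Submodule.smul_mem_smul hr (Submodule.mem_top (x := x))
  rwa [hk] at this

theorem isFiniteLength_quotient_of_pow_smul_le (hq : q.radical = IsLocalRing.maximalIdeal R)
    {k : ℕ} {A : Submodule R M} (h : q ^ k • (⊤ : Submodule R M) ≤ A) :
    IsFiniteLength R (M ⧸ A) := by
  obtain ⟨j, hj⟩ := q.exists_radical_pow_le_of_fg (IsNoetherian.noetherian _)
  rw [hq] at hj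
  refine isFiniteLength_of_supportDim_le_zero
    (supportDim_le_zero_of_pow_le_annihilator (k := j * k) fun r hr => ?_)
  rw [pow_mul] at hr
  rw [Module.mem_annihilator]
  intro y
  obtain ⟨x, rfl⟩ := A.mkQ_surjective y
  exact (Submodule.Quotient.mk_eq_zero A).mpr
    (h (Submodule.smul_mem_smul (Ideal.pow_right_mono hj k hr) trivial))

end Local

/-! ### Good filtrations, superficial elements and the Ratliff–Rush filtration. -/

section Filtration

variable {R : Type*} [CommRing R] {M : Type*} [AddCommGroup M] [Module R M] {q : Ideal R}

theorem IsGood.pow_smul_top_le {F : q.Filtration M} (hF : F.N 0 = ⊤) (n : ℕ) :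
    q ^ n • (⊤ : Submodule R M) ≤ F.N n := by
  simpa [hF] using F.pow_smul_le n 0

theorem IsGood.quotFiltration {F : q.Filtration M} (hF : IsGood F) (P : Submodule R M) :
    IsGood (quotFiltration F P) where
  zero := by
    change (F.N 0).map P.mkQ = ⊤
    rw [hF.zero, Submodule.map_top, Submodule.range_mkQ]
  stable := by
    obtain ⟨n₀, h⟩ := hF.stable
    refine ⟨n₀, fun n hn => ?_⟩
    change q • (F.N n).map P.mkQ = (F.N (n + 1)).map P.mkQ
    rw [← h n hn, Submodule.map_smul'']

theorem IsSuperficial.of_quotFiltration_bot {F : q.Filtration M} {a : R} {P : Submodule R M}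
    (hP : P = ⊥) (h : IsSuperficial (quotFiltration F P) a) : IsSuperficial F a := by
  obtain ⟨ha, c, hc⟩ := h
  have hmem : ∀ n x, P.mkQ x ∈ (quotFiltration F P).N n ↔ x ∈ F.N n := by
    intro n x
    change x ∈ ((F.N n).map P.mkQ).comap P.mkQ ↔ _
    rw [Submodule.comap_map_mkQ, hP, bot_sup_eq]
  refine ⟨ha, c, fun n hn => ?_⟩
  ext x
  have := SetLike.ext_iff.mp (hc n hn) (P.mkQ x)
  rw [Submodule.mem_inf, mem_colonElem, ← map_smul, hmem, hmem, hmem] at this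
  exact this

variable [IsNoetherianRing R] [Module.Finite R M]

/-- Artin–Rees for the principal submodule `a M` and a good filtration. -/
theorem IsGood.exists_inf_smul_top_le {F : q.Filtration M} (hF : IsGood F) (a : R) (c : ℕ) :
    ∃ n₀, ∀ n ≥ n₀, F.N n ⊓ a • (⊤ : Submodule R M) ≤ a • F.N c := by
  obtain ⟨n₀, h⟩ := (hF.stable.inter_right
    (F' := q.trivialFiltration (a • (⊤ : Submodule R M)))).exists_pow_smul_eq
  refine ⟨n₀ + c, fun n hn => ?_⟩
  refine (inf_le_inf_right _ (F.antitone hn)).trans ?_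
  have h1 : F.N (n₀ + c) ⊓ a • (⊤ : Submodule R M) =
      q ^ c • (F.N n₀ ⊓ a • (⊤ : Submodule R M)) := h c
  rw [h1]
  calc q ^ c • (F.N n₀ ⊓ a • (⊤ : Submodule R M))
      ≤ q ^ c • (a • (⊤ : Submodule R M)) := smul_mono_right _ inf_le_right
    _ = a • (q ^ c • (⊤ : Submodule R M)) := by
        rw [← Submodule.ideal_span_singleton_smul, ← Submodule.ideal_span_singleton_smul,
          ← Submodule.mul_smul, ← Submodule.mul_smul, mul_comm]
    _ ≤ a • F.N c := by
        rw [← Submodule.ideal_span_singleton_smul, ← Submodule.ideal_span_singleton_smul]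
        exact smul_mono_right _ (IsGood.pow_smul_top_le hF.zero c)

variable [IsLocalRing R]

theorem IsGood.iInf_eq_bot {F : q.Filtration M} (hF : IsGood F) (hq : q ≠ ⊤) (c : ℕ) {x : M}
    (hx : ∀ n ≥ c, x ∈ F.N n) : x = 0 := by
  obtain ⟨n₀, h⟩ := hF.stable.exists_pow_smul_eq
  rw [← Submodule.mem_bot R, ← Ideal.iInf_pow_smul_eq_bot_of_isLocalRing (M := M) q hq,
    Submodule.mem_iInf]
  intro k
  have h1 := F.antitone (show n₀ + k ≤ n₀ + k + c by omega) (hx (n₀ + k + c) (by omega))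
  rw [h k] at h1
  exact Submodule.smul_mono le_rfl le_top h1

/-- An element of `F_c` killed by `a` lies in every colon `(F_{m+1} : a) ∩ F_c = F_m`, hence in the
zero intersection of the filtration. -/
theorem IsSuperficial.exists_inf_ker_eq_bot {F : q.Filtration M} (hF : IsGood F) (hq : q ≠ ⊤)
    {a : R} (ha : IsSuperficial F a) :
    ∃ c, ∀ n ≥ c, F.N n ⊓ LinearMap.ker (LinearMap.lsmul R M a) = ⊥ := by
  obtain ⟨-, c, hc⟩ := ha
  refine ⟨c, fun n hn => ?_⟩
  rw [eq_bot_iff]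
  rintro x ⟨hx, hx0⟩
  have hx0 : a • x = 0 := hx0
  have hxc := F.antitone hn hx
  refine hF.iInf_eq_bot hq c (x := x) fun m hm => ?_
  rw [← hc m hm]
  exact ⟨mem_colonElem.mpr (hx0 ▸ zero_mem _), hxc⟩

omit [IsLocalRing R] in
-- By Artin–Rees, `a x ∈ F_{n+1}` equals `a y` with `y ∈ F_c`. Superficiality puts `y` in `F_n`, and
-- `x - y` is killed by `a`.
theorem IsSuperficial.exists_colonElem_eq {F : q.Filtration M} (hF : IsGood F)
    {a : R} (ha : IsSuperficial F a) :
    ∃ n₀, ∀ n ≥ n₀, colonElem (F.N (n + 1)) a = F.N n ⊔ LinearMap.ker (LinearMap.lsmul R M a) := by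
  obtain ⟨haq, c, hc⟩ := ha
  obtain ⟨n₀, h⟩ := hF.exists_inf_smul_top_le a c
  refine ⟨n₀ + c, fun n hn => le_antisymm (fun x hx => ?_) (sup_le ?_ ?_)⟩
  · rw [mem_colonElem] at hx
    have h1 := h (n + 1) (by omega) ⟨hx, Submodule.smul_mem_pointwise_smul x a ⊤ trivial⟩
    obtain ⟨y, hy, hxy⟩ := (Submodule.mem_smul_pointwise_iff_exists _ _ _).mp h1
    rw [← hc n (by omega)]
    refine Submodule.mem_sup.mpr ⟨y, ⟨?_, hy⟩, x - y, ?_, by abel⟩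
    · exact mem_colonElem.mpr (hxy ▸ hx)
    · rw [LinearMap.mem_ker, LinearMap.lsmul_apply, smul_sub, hxy, sub_self]
  · exact fun x hx => F.smul_le n (Submodule.smul_mem_smul haq hx)
  · intro x hx
    have hx : a • x = 0 := hx
    rw [mem_colonElem, hx]
    exact zero_mem _

omit [IsNoetherianRing R] [Module.Finite R M] in
theorem exists_isSMulRegular_of_depth_pos (h : 0 < depth R M) :
    ∃ r ∈ IsLocalRing.maximalIdeal R, IsSMulRegular M r := by
  unfold depth at h
  simp only [lt_iSup_iff] at h
  obtain ⟨rs, hm, hr, hl⟩ := h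
  cases rs with
  | nil => simp at hl
  | cons r rs =>
    exact ⟨r, hm r (by simp), ((RingTheory.Sequence.isRegular_cons_iff M r rs).mp hr).1⟩

/-- A power of an `M`-regular element lies in `q ^ c`, so it moves the kernel of `a` injectively
into `F_c`, which meets that kernel trivially. -/
theorem IsSuperficial.isSMulRegular {F : q.Filtration M} (hF : IsGood F)
    (hqm : q.radical = IsLocalRing.maximalIdeal R) (hd : 0 < depth R M)
    {a : R} (ha : IsSuperficial F a) : IsSMulRegular M a := by
  have hq : q ≠ ⊤ := by
    rintro rfl
    rw [Ideal.radical_top] at hqm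
    exact Ideal.IsPrime.ne_top' hqm.symm
  obtain ⟨c, hc⟩ := ha.exists_inf_ker_eq_bot hF hq
  obtain ⟨r, hr, hreg⟩ := exists_isSMulRegular_of_depth_pos hd
  rw [isSMulRegular_iff_right_eq_zero_of_smul]
  intro x hx
  rw [← hqm] at hr
  obtain ⟨k, hk⟩ := hr
  refine (hreg.pow (k * c)).right_eq_zero_of_smul ?_
  have h1 : r ^ (k * c) ∈ q ^ c := by
    rw [pow_mul]; exact Ideal.pow_mem_pow hk c
  rw [← Submodule.mem_bot R, ← hc c le_rfl]
  refine ⟨IsGood.pow_smul_top_le hF.zero c (Submodule.smul_mem_smul h1 trivial), ?_⟩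
  refine LinearMap.mem_ker.mpr ?_
  rw [LinearMap.lsmul_apply, smul_comm, hx, smul_zero]

omit [IsNoetherianRing R] [Module.Finite R M] [IsLocalRing R] in
theorem mem_ratliffRush {F : q.Filtration M} {n : ℕ} {x : M} :
    x ∈ (ratliffRush F).N n ↔ ∃ k ≥ 1, ∀ r ∈ q ^ k, r • x ∈ F.N (n + k) := by
  change x ∈ ⋃ k ≥ 1, (colonIdeal (F.N (n + k)) (q ^ k) : Set M) ↔ _
  simp only [Set.mem_iUnion, SetLike.mem_coe, exists_prop]
  rfl

omit [IsNoetherianRing R] [Module.Finite R M] [IsLocalRing R] in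
theorem le_ratliffRush (F : q.Filtration M) (n : ℕ) : F.N n ≤ (ratliffRush F).N n := by
  intro x hx
  rw [mem_ratliffRush]
  refine ⟨1, le_rfl, fun r hr => F.smul_le n (Submodule.smul_mem_smul ?_ hx)⟩
  simpa using hr

omit [IsNoetherianRing R] [Module.Finite R M] [IsLocalRing R] in
-- Testing membership on `a ^ k ∈ q ^ k` alone suffices: the factors `a` are cancelled one at a
-- time.
theorem ratliffRush_eq_of_colonElem_eq {F : q.Filtration M} {a : R} (haq : a ∈ q) {n₀ : ℕ}
    (h : ∀ n ≥ n₀, colonElem (F.N (n + 1)) a = F.N n) {n : ℕ} (hn : n₀ ≤ n) :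
    (ratliffRush F).N n = F.N n := by
  refine le_antisymm (fun x hx => ?_) (le_ratliffRush F n)
  obtain ⟨k, -, hk⟩ := mem_ratliffRush.mp hx
  have h1 := hk (a ^ k) (Ideal.pow_mem_pow haq k)
  clear hk hx
  induction k with
  | zero => simpa using h1
  | succ k ih =>
    apply ih
    rw [← h (n + k) (by omega), mem_colonElem, ← mul_smul, ← pow_succ']
    exact h1

omit [IsNoetherianRing R] [Module.Finite R M] [IsLocalRing R] in
-- The identity holds for all `n`, not only large ones: replacing `k` by `k + n₀` in the
-- Ratliff–Rush condition moves everything into degrees where `a` cancels in `F`.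
theorem colonElem_ratliffRush {F : q.Filtration M} {a : R} (haq : a ∈ q) {n₀ : ℕ}
    (h : ∀ n ≥ n₀, colonElem (F.N (n + 1)) a = F.N n) (n : ℕ) :
    colonElem ((ratliffRush F).N (n + 1)) a = (ratliffRush F).N n := by
  refine le_antisymm (fun x hx => ?_) fun x hx =>
    (ratliffRush F).smul_le n (Submodule.smul_mem_smul haq hx)
  obtain ⟨k, hk1, hk⟩ := mem_ratliffRush.mp hx
  refine mem_ratliffRush.mpr ⟨k + n₀, by omega, fun r hr => ?_⟩
  rw [← h (n + (k + n₀)) (by omega), mem_colonElem]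
  rw [pow_add] at hr
  refine Submodule.mul_induction_on hr (fun s hs t ht => ?_) fun s t hs ht => ?_
  · have h2 := F.pow_smul_le n₀ _ (Submodule.smul_mem_smul ht (hk s hs))
    rw [show n + (k + n₀) + 1 = n₀ + (n + 1 + k) by omega]
    rw [LinearMap.lsmul_apply, smul_smul, smul_smul] at h2
    rw [smul_smul, show a * (s * t) = t * (s * a) by ring, mul_assoc] at *
    exact h2
  · rw [add_smul, smul_add]
    exact add_mem hs ht

end Filtration

/-! ### Colengths as natural numbers and Hilbert functions. -/

theorem enat_add_ne_top {x y : ℕ∞} : x + y ≠ ⊤ ↔ x ≠ ⊤ ∧ y ≠ ⊤ := WithTop.add_ne_top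

theorem withBot_enat_add_one_le_iff {d e : WithBot ℕ∞} : d + 1 ≤ e + 1 ↔ d ≤ e := by
  induction d with
  | bot => simp
  | coe d =>
    induction e with
    | bot => simp
    | coe e =>
      norm_cast
      exact ENat.add_le_add_iff_right (by simp)

section Colength

variable {R : Type*} [CommRing R] {M : Type*} [AddCommGroup M] [Module R M]

/-- The length of `M / A` as a natural number (`0` when infinite). -/
noncomputable def colength (A : Submodule R M) : ℕ := (Module.length R (M ⧸ A)).toNat

theorem length_quotient_ne_top_of_le {A B : Submodule R M} (h : B ≤ A)
    (hB : Module.length R (M ⧸ B) ≠ ⊤) : Module.length R (M ⧸ A) ≠ ⊤ :=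
  ne_top_of_le_ne_top hB (Module.length_le_of_surjective _ (Submodule.factor_surjective h))

theorem colength_anti {A B : Submodule R M} (h : B ≤ A)
    (hB : Module.length R (M ⧸ B) ≠ ⊤) : colength A ≤ colength B :=
  ENat.toNat_le_toNat (Module.length_le_of_surjective _ (Submodule.factor_surjective h)) hB

theorem toNat_lengthQuot_add_colength {A B : Submodule R M} (h : B ≤ A)
    (hB : Module.length R (M ⧸ B) ≠ ⊤) :
    (lengthQuot A B).toNat + colength A = colength B := by
  have h1 := length_quotient_eq_lengthQuot_add h
  have h2 := hB
  rw [h1, enat_add_ne_top] at h2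
  rw [colength, colength, h1, ENat.toNat_add h2.1 h2.2]

theorem colength_eq_colonElem_add {B : Submodule R M} (hB : Module.length R (M ⧸ B) ≠ ⊤) (a : R) :
    colength B = colength (colonElem B a) + colength (B ⊔ a • (⊤ : Submodule R M)) := by
  have h1 := length_quotient_eq_colonElem_add B a
  have h2 := hB
  rw [h1, enat_add_ne_top] at h2
  rw [colength, h1, ENat.toNat_add h2.1 h2.2]
  rfl

theorem eq_of_colength_eq {A B : Submodule R M} (h : B ≤ A)
    (hB : Module.length R (M ⧸ B) ≠ ⊤) (hAB : colength A = colength B) : A = B := by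
  have h1 := toNat_lengthQuot_add_colength h hB
  have h2 := hB
  rw [length_quotient_eq_lengthQuot_add h, enat_add_ne_top] at h2
  have h3 : lengthQuot A B = 0 := by
    have : (lengthQuot A B).toNat = 0 := by omega
    rw [ENat.toNat_eq_zero] at this
    exact this.resolve_right h2.1
  rw [lengthQuot, Module.length_eq_zero_iff, Submodule.Quotient.subsingleton_iff,
    Submodule.submoduleOf_eq_top] at h3
  exact le_antisymm h3 h

theorem natCast_hilbertFunction {q : Ideal R} {F : q.Filtration M}
    (hF : ∀ n, Module.length R (M ⧸ F.N n) ≠ ⊤) (n : ℕ) :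
    (hilbertFunction F n : ℤ) = colength (F.N (n + 1)) - colength (F.N n) := by
  rw [← toNat_lengthQuot_add_colength (F.mono n) (hF (n + 1)), hilbertFunction]
  push_cast
  ring

/-- Partial sums see only the last term of the filtration, so filtrations that agree eventually have
equal partial sums eventually. -/
theorem sum_hilbertFunction {q : Ideal R} {F : q.Filtration M} (h0 : F.N 0 = ⊤)
    (hF : ∀ n, Module.length R (M ⧸ F.N n) ≠ ⊤) (n : ℕ) :
    ∑ i ∈ Finset.range n, (hilbertFunction F i : ℤ) = colength (F.N n) := by
  induction n with
  | zero =>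
    have : Subsingleton (M ⧸ F.N 0) := Submodule.Quotient.subsingleton_iff.mpr h0
    simp [colength]
  | succ n ih => rw [Finset.sum_range_succ, ih, natCast_hilbertFunction hF]; ring

/-- Multiplication by `a ∈ q` bounds the growth of the colengths of a `q`-filtration. -/
theorem colength_succ_le {q : Ideal R} {F : q.Filtration M} {a : R} (ha : a ∈ q)
    (hF : ∀ n, Module.length R (M ⧸ F.N n) ≠ ⊤)
    (hfin : Module.length R (M ⧸ a • (⊤ : Submodule R M)) ≠ ⊤) (n : ℕ) :
    colength (F.N (n + 1)) ≤ colength (F.N n) + colength (a • (⊤ : Submodule R M)) := by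
  rw [colength_eq_colonElem_add (hF (n + 1)) a]
  refine add_le_add (colength_anti ?_ (hF n)) (colength_anti le_sup_right hfin)
  exact fun x hx => F.smul_le n (Submodule.smul_mem_smul ha hx)

end Colength

/-! ### Growth of colengths in dimension at most one. -/

section DimensionOne

variable {R : Type*} [CommRing R] [IsNoetherianRing R] [IsLocalRing R]
  {M : Type*} [AddCommGroup M] [Module R M] [Module.Finite R M] {q : Ideal R}

theorem IsGood.length_quotient_ne_top {F : q.Filtration M} (hF : F.N 0 = ⊤)
    (hqm : q.radical = IsLocalRing.maximalIdeal R) (n : ℕ) :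
    Module.length R (M ⧸ F.N n) ≠ ⊤ :=
  Module.length_ne_top_iff.mpr
    (isFiniteLength_quotient_of_pow_smul_le hqm (IsGood.pow_smul_top_le hF n))

/-- `a` need not be regular on `M` but is regular on `A`, so `A / aA` has dimension at most zero and
finite length. Then `M / aA` has finite length and surjects onto `M / aM`. -/
theorem length_quotient_smul_top_ne_top (hdim : Module.supportDim R M ≤ 1) {a : R}
    (ha : a ∈ IsLocalRing.maximalIdeal R) {A : Submodule R M}
    (hA : Module.length R (M ⧸ A) ≠ ⊤) (hker : A ⊓ LinearMap.ker (LinearMap.lsmul R M a) = ⊥) :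
    Module.length R (M ⧸ a • (⊤ : Submodule R M)) ≠ ⊤ := by
  have hreg : IsSMulRegular A a := by
    rw [isSMulRegular_iff_right_eq_zero_of_smul]
    rintro ⟨x, hx⟩ h
    have h' : a • x = 0 := congrArg Subtype.val h
    have : x ∈ A ⊓ LinearMap.ker (LinearMap.lsmul R M a) := ⟨hx, h'⟩
    rw [hker, Submodule.mem_bot] at this
    exact Subtype.ext this
  have h1 := Module.supportDim_quotSMulTop_succ_eq_supportDim hreg ha
  have h2 := Module.supportDim_le_of_injective A.subtype A.subtype_injective
  have h3 : Module.supportDim R (QuotSMulTop a A) ≤ 0 := by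
    refine withBot_enat_add_one_le_iff.mp ?_
    rw [zero_add]
    exact h1.le.trans (h2.trans hdim)
  have h6 := Module.length_ne_top_iff.mpr (isFiniteLength_of_supportDim_le_zero h3)
  have h7 : (a • A).submoduleOf A = a • (⊤ : Submodule R A) := by
    ext ⟨x, hx⟩
    change x ∈ a • A ↔ _
    rw [Submodule.mem_smul_pointwise_iff_exists,
      Submodule.mem_smul_pointwise_iff_exists]
    constructor
    · rintro ⟨y, hy, rfl⟩
      exact ⟨⟨y, hy⟩, trivial, rfl⟩
    · rintro ⟨y, -, h⟩
      exact ⟨y, y.2, congrArg Subtype.val h⟩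
  have h8 : lengthQuot A (a • A) ≠ ⊤ := by
    rw [lengthQuot, h7]; exact h6
  have hle : a • A ≤ A := Submodule.smul_le_self_of_tower a A
  refine length_quotient_ne_top_of_le (B := a • A) (smul_mono_right a le_top) ?_
  rw [length_quotient_eq_lengthQuot_add hle]
  exact enat_add_ne_top.mpr ⟨h8, hA⟩

/-- The eventual growth of the colengths of a good filtration, for a superficial element `a` with
`M / a M` of finite length. -/
theorem IsSuperficial.exists_colength_succ_add_eq {F : q.Filtration M} (hF : IsGood F)
    (hqm : q.radical = IsLocalRing.maximalIdeal R) (hdim : Module.supportDim R M ≤ 1)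
    {a : R} (ha : IsSuperficial F a) :
    Module.length R (M ⧸ a • (⊤ : Submodule R M)) ≠ ⊤ ∧
    Module.length R (LinearMap.ker (LinearMap.lsmul R M a)) ≠ ⊤ ∧
    ∃ n₀, ∀ n ≥ n₀, colength (F.N (n + 1)) +
        (Module.length R (LinearMap.ker (LinearMap.lsmul R M a))).toNat =
      colength (F.N n) + colength (a • (⊤ : Submodule R M)) := by
  have hqle : q ≤ IsLocalRing.maximalIdeal R := hqm ▸ Ideal.le_radical
  have hq : q ≠ ⊤ := fun h => Ideal.IsPrime.ne_top' (top_le_iff.mp (h ▸ hqle))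
  have hfin := IsGood.length_quotient_ne_top hF.zero hqm
  obtain ⟨c, hc⟩ := ha.exists_inf_ker_eq_bot hF hq
  obtain ⟨n₁, hn₁⟩ := ha.exists_colonElem_eq hF
  have h1 := length_quotient_smul_top_ne_top hdim (hqle ha.1) (hfin c) (hc c le_rfl)
  obtain ⟨k, hk⟩ := exists_pow_smul_top_eq_bot hq (Module.length_ne_top_iff.mp h1)
  have hk' : q ^ k • (⊤ : Submodule R M) ≤ a • (⊤ : Submodule R M) := by
    intro x hx
    rw [← Submodule.Quotient.mk_eq_zero, ← Submodule.mem_bot R, ← hk,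
      ← Submodule.range_mkQ (a • (⊤ : Submodule R M)), ← Submodule.map_top, ← Submodule.map_smul'']
    exact ⟨x, hx, rfl⟩
  obtain ⟨m, hm⟩ := hF.stable.exists_pow_smul_eq
  have h2 : ∀ n ≥ c, lengthQuot (F.N n ⊔ LinearMap.ker (LinearMap.lsmul R M a)) (F.N n) =
      Module.length R (LinearMap.ker (LinearMap.lsmul R M a)) :=
    fun n hn => lengthQuot_sup_eq_length (hc n hn)
  refine ⟨h1, ?_, n₁ + c + (m + k), fun n hn => ?_⟩
  -- The kernel is isomorphic to `(F_c + ker a) / F_c`, a submodule of the finite-length module `M /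
  -- F_c`.
  · rw [← h2 c le_rfl]
    have h3 := hfin c
    rw [length_quotient_eq_lengthQuot_add
      (le_sup_left (b := LinearMap.ker (LinearMap.lsmul R M a))), enat_add_ne_top] at h3
    exact h3.1
  -- For large `n`, `F_{n+1} ⊆ aM`, so the cokernel term in the colon sequence is the constant `λ(M
  -- / aM)`.
  · have h3 : F.N (n + 1) ≤ a • (⊤ : Submodule R M) := by
      refine (F.antitone (show m + k ≤ n + 1 by omega)).trans ?_
      rw [hm k]
      exact (Submodule.smul_mono le_rfl le_top).trans hk'
    rw [colength_eq_colonElem_add (hfin (n + 1)) a, sup_eq_right.mpr h3, hn₁ n (by omega),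
      ← toNat_lengthQuot_add_colength
        (le_sup_left (b := LinearMap.ker (LinearMap.lsmul R M a))) (hfin n), h2 n (by omega)]
    ring

end DimensionOne

end HilbertFiltration

/-! ### Hilbert coefficients from an eventually linear function. -/

theorem PowerSeries.coeff_succ_mul_one_sub_X (P : PowerSeries ℤ) (n : ℕ) :
    PowerSeries.coeff (n + 1) (P * (1 - PowerSeries.X)) =
      PowerSeries.coeff (n + 1) P - PowerSeries.coeff n P := by
  rw [mul_sub, mul_one, map_sub, PowerSeries.coeff_succ_mul_X]

theorem PowerSeries.coeff_zero_mul_one_sub_X (P : PowerSeries ℤ) :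
    PowerSeries.coeff 0 (P * (1 - PowerSeries.X)) = PowerSeries.coeff 0 P := by
  rw [mul_sub, mul_one, map_sub, PowerSeries.coeff_zero_mul_X, sub_zero]

/-- The first three moments of the coefficients of `(1 - X)² ∑ H(n) Xⁿ`. -/
theorem PowerSeries.sum_coeff_mul_one_sub_X_sq (H : ℕ → ℤ) (n : ℕ) :
    let c := fun k => PowerSeries.coeff k (PowerSeries.mk H * (1 - PowerSeries.X) ^ 2)
    ∑ k ∈ Finset.range (n + 2), c k = H (n + 1) - H n ∧
    ∑ k ∈ Finset.range (n + 2), (k : ℤ) * c k = (n + 1) * H (n + 1) - (n + 2) * H n ∧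
    2 * ∑ k ∈ Finset.range (n + 2), (k.choose 2 : ℤ) * c k =
      2 * ∑ i ∈ Finset.range (n + 2), H i - (n + 3) * (n + 2) * (H (n + 1) - H n)
        + 2 * (n + 2) * ((n + 1) * H (n + 1) - (n + 2) * H n) := by
  intro c
  have h0 : c 0 = H 0 := by
    simp only [c, pow_two, ← mul_assoc, coeff_zero_mul_one_sub_X, coeff_mk]
  have h1 : c 1 = H 1 - 2 * H 0 := by
    simp only [c, pow_two, ← mul_assoc]
    rw [coeff_succ_mul_one_sub_X _ 0, coeff_succ_mul_one_sub_X _ 0, coeff_zero_mul_one_sub_X]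
    simp only [coeff_mk]
    ring
  have h2 : ∀ k, c (k + 2) = H (k + 2) - 2 * H (k + 1) + H k := by
    intro k
    simp only [c, pow_two, ← mul_assoc]
    rw [coeff_succ_mul_one_sub_X, coeff_succ_mul_one_sub_X, coeff_succ_mul_one_sub_X]
    simp only [coeff_mk]
    ring
  have hch : ∀ k : ℕ, 2 * ((k + 2).choose 2 : ℤ) = (k + 2) * (k + 1) := by
    intro k
    induction k with
    | zero => simp
    | succ k ih =>
      rw [Nat.choose_succ_succ' (k + 2) 1, Nat.choose_one_right]
      push_cast
      linarith
  induction n with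
  | zero =>
    refine ⟨?_, ?_, ?_⟩ <;>
    · simp [Finset.sum_range_succ, h0, h1]
      try ring
  | succ n ih =>
    obtain ⟨i0, i1, i2⟩ := ih
    refine ⟨?_, ?_, ?_⟩
    · rw [Finset.sum_range_succ, i0, h2]; ring
    · rw [Finset.sum_range_succ, i1, h2]; push_cast; ring
    · rw [Finset.sum_range_succ, mul_add, i2, Finset.sum_range_succ _ (n + 2), h2, ← mul_assoc,
        hch]
      push_cast; ring

theorem Polynomial.eval_one_hasseDeriv_eq_sum (h : ℤ[X]) (i m : ℕ) (hm : h.natDegree < m) :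
    (hasseDeriv i h).eval 1 = ∑ k ∈ Finset.range m, (k.choose i : ℤ) * h.coeff k := by
  rw [hasseDeriv_apply, Polynomial.sum_over_range' _ _ m hm, eval_finsetSum]
  · simp
  · simp

/-- If `H(n) = e₀ (n + 1) - e₁` for large `n` then `(1 - X)² ∑ H(n) Xⁿ` is a polynomial. -/
theorem PowerSeries.exists_polynomial_of_eventually_linear {H : ℕ → ℤ} {e₀ e₁ : ℤ} {n₀ : ℕ}
    (hH : ∀ n ≥ n₀, H n = e₀ * (n + 1) - e₁) :
    ∃ h : ℤ[X], PowerSeries.mk H * (1 - PowerSeries.X) ^ 2 = (h : PowerSeries ℤ) := by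
  set P := PowerSeries.mk H * (1 - PowerSeries.X) ^ 2 with hP
  refine ⟨P.trunc (n₀ + 2), ?_⟩
  ext m
  rw [Polynomial.coeff_coe, PowerSeries.coeff_trunc]
  split_ifs with hm
  · rfl
  · obtain ⟨k, rfl⟩ := Nat.exists_eq_add_of_le (not_lt.mp hm)
    rw [hP, show n₀ + 2 + k = (n₀ + k) + 1 + 1 by omega, pow_two, ← mul_assoc,
      coeff_succ_mul_one_sub_X, coeff_succ_mul_one_sub_X, coeff_succ_mul_one_sub_X]
    simp only [coeff_mk]
    rw [hH _ (by omega), hH _ (by omega), hH _ (by omega)]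
    push_cast
    ring

/-- The Hilbert coefficients read off from an eventually linear Hilbert function. -/
theorem PowerSeries.hasseDeriv_eval_of_eventually_linear {H : ℕ → ℤ} {e₀ e₁ : ℤ} {n₀ : ℕ}
    (hH : ∀ n ≥ n₀, H n = e₀ * (n + 1) - e₁) {h : ℤ[X]}
    (hh : PowerSeries.mk H * (1 - PowerSeries.X) ^ 2 = (h : PowerSeries ℤ)) :
    h.eval 1 = e₀ ∧ (hasseDeriv 0 h).eval 1 = e₀ ∧ (hasseDeriv 1 h).eval 1 = e₁ ∧
      ∃ n₁, ∀ n ≥ n₁, (hasseDeriv 2 h).eval 1 =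
        ∑ i ∈ Finset.range n, (H i - (e₀ * (i + 1) - e₁)) := by
  have hc : ∀ k, h.coeff k =
      PowerSeries.coeff k (PowerSeries.mk H * (1 - PowerSeries.X) ^ 2) := by
    intro k; rw [hh, Polynomial.coeff_coe]
  -- Beyond this bound the range contains every coefficient of `h`, and both `H n` and `H (n + 1)`
  -- are given by the linear formula.
  have key : ∀ n ≥ n₀ + h.natDegree, (hasseDeriv 0 h).eval 1 = e₀ ∧
      (hasseDeriv 1 h).eval 1 = e₁ ∧ (hasseDeriv 2 h).eval 1 =
        ∑ i ∈ Finset.range (n + 2), (H i - (e₀ * (i + 1) - e₁)) := by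
    intro n hn
    obtain ⟨s0, s1, s2⟩ := PowerSeries.sum_coeff_mul_one_sub_X_sq H n
    have hs : ∀ m : ℕ, 2 * ∑ i ∈ Finset.range m, (e₀ * ((i : ℤ) + 1) - e₁) =
        e₀ * ((m + 1) * m) - 2 * e₁ * m := by
      intro m
      induction m with
      | zero => simp
      | succ m ih => rw [Finset.sum_range_succ, mul_add, ih]; push_cast; ring
    have hs := hs (n + 2)
    rw [hH n (by omega), hH (n + 1) (by omega)] at s0 s1 s2
    simp_rw [Polynomial.eval_one_hasseDeriv_eq_sum h _ (n + 2) (by omega), hc]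
    refine ⟨?_, ?_, ?_⟩
    · simp only [Nat.choose_zero_right, Nat.cast_one, one_mul]
      rw [s0]; push_cast; ring
    · simp only [Nat.choose_one_right]
      rw [s1]; push_cast; ring
    · rw [Finset.sum_sub_distrib]
      push_cast at s2 hs ⊢
      linarith
  obtain ⟨k0, k1, -⟩ := key _ le_rfl
  refine ⟨by rwa [hasseDeriv_zero'] at k0, k0, k1, n₀ + h.natDegree + 2, fun n hn => ?_⟩
  obtain ⟨m, rfl⟩ := Nat.exists_eq_add_of_le' (show 2 ≤ n by omega)
  exact (key m (by omega)).2.2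

/-! ### Postulation number and the bound on the total deviation. -/

/-- Summing from above a sequence with jumps at most `l` that vanishes beyond `s`. -/
theorem sum_ge_of_sub_le {D : ℕ → ℤ} {l : ℤ} (hD : ∀ n, D (n + 1) - D n ≤ l) {s : ℕ}
    (hs : D (s + 1) = 0) :
    -(Ring.choose ((s : ℤ) + 2) 2 * l) ≤ ∑ i ∈ Finset.range (s + 1), D i := by
  -- Descending from the zero at `s + 1`, each step down loses at most `l`.
  have h1 : ∀ j ≤ s + 1, -(j * l) ≤ D (s + 1 - j) := by
    intro j
    induction j with
    | zero => intro _; simp [hs]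
    | succ j ih =>
      intro hj
      have h2 := ih (by omega)
      have h3 := hD (s + 1 - (j + 1))
      rw [show s + 1 - (j + 1) + 1 = s + 1 - j by omega] at h3
      rw [show s + 1 - (j + 1) = s - j by omega] at h3 ⊢
      push_cast
      linarith
  have h2 : ∀ i ∈ Finset.range (s + 1), -(((s : ℤ) + 1 - i) * l) ≤ D i := by
    intro i hi
    have hi := Finset.mem_range.mp hi
    have := h1 (s + 1 - i) (by omega)
    rw [show s + 1 - (s + 1 - i) = i by omega, Nat.cast_sub (by omega)] at this
    push_cast at this
    exact this
  refine le_trans (le_of_eq ?_) (Finset.sum_le_sum h2)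
  rw [Finset.sum_neg_distrib, ← Finset.sum_mul]
  congr 2
  have h3 : (2 : ℤ) * Ring.choose ((s : ℤ) + 2) 2 = (s + 2) * (s + 1) := by
    have : ((s : ℤ) + 2) = ((s + 2 : ℕ) : ℤ) := by push_cast; rfl
    rw [this, Ring.choose_natCast, ← Nat.cast_two, ← Nat.cast_mul, mul_comm,
      Nat.choose_two_right, Nat.div_mul_cancel (Nat.even_mul_pred_self _).two_dvd]
    push_cast
    rfl
  have h4 : ∀ m : ℕ, m ≤ s + 1 → (2 : ℤ) * ∑ i ∈ Finset.range m, ((s : ℤ) + 1 - i) =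
      m * (2 * s + 3 - m) := by
    intro m hm
    induction m with
    | zero => simp
    | succ m ih => rw [Finset.sum_range_succ, mul_add, ih (by omega)]; push_cast; ring
  have h4 := h4 (s + 1) le_rfl
  push_cast at h4
  linarith

/-- The postulation number of an eventually linear function, and the bound it gives on the total
deviation when the jumps of the function exceed the slope by at most `l`. -/
theorem exists_isGreatest_ne_of_eventually_linear {H : ℕ → ℤ} {e₀ e₁ l : ℤ} {n₀ : ℕ}
    (hH : ∀ n ≥ n₀, H n = e₀ * (n + 1) - e₁) (he : e₀ ≠ 0)
    (hjump : ∀ n, H (n + 1) - H n ≤ e₀ + l) :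
    ∃ s : ℤ, IsGreatest {n : ℤ | (if 0 ≤ n then H n.toNat else 0) ≠ e₀ * (n + 1) - e₁} s ∧
      ∀ E n₁, (∀ n ≥ n₁, E = ∑ i ∈ Finset.range n, (H i - (e₀ * (i + 1) - e₁))) →
        -(Ring.choose (s + 2) 2 * l) ≤ E := by
  set S := {n : ℤ | (if 0 ≤ n then H n.toNat else 0) ≠ e₀ * (n + 1) - e₁} with hS
  have hnat : ∀ n : ℕ, (n : ℤ) ∈ S ↔ H n - (e₀ * (n + 1) - e₁) ≠ 0 := by
    intro n
    simp [hS, sub_ne_zero]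
  have hbdd : ∀ z ∈ S, z ≤ n₀ := by
    intro z hz
    by_contra hlt
    lift z to ℕ using by omega
    exact (hnat z).mp hz (sub_eq_zero.mpr (hH z (by omega)))
  -- In negative degrees `H = 0`, while `p(-1) = -e₁` and `p(-2) = -e₀ - e₁` cannot both vanish
  -- because `e₀ ≠ 0`. This gives existence of `s` and `s ≥ -2`.
  have hlow : ∃ z ∈ S, -2 ≤ z := by
    by_cases h1 : (-1 : ℤ) ∈ S
    · exact ⟨-1, h1, by omega⟩
    · refine ⟨-2, ?_, le_rfl⟩
      simp only [hS, Set.mem_ofPred_eq, not_not] at h1 ⊢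
      norm_num at h1 ⊢
      omega
  obtain ⟨z, hz, hz2⟩ := hlow
  obtain ⟨s, hs, hmax⟩ := Int.exists_greatest_of_bdd (P := (· ∈ S)) ⟨n₀, hbdd⟩ ⟨z, hz⟩
  have hs2 : -2 ≤ s := hz2.trans (hmax z hz)
  have hzero : ∀ n : ℕ, s < n → H n - (e₀ * (n + 1) - e₁) = 0 := by
    intro n hn
    by_contra h
    exact absurd (hmax n ((hnat n).mpr h)) (by omega)
  refine ⟨s, ⟨hs, hmax⟩, fun E n₁ hE => ?_⟩
  rcases le_or_gt 0 s with h0 | h0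
  · lift s to ℕ using h0
    rw [hE (n₁ + (s + 1)) (by omega), add_comm n₁, Finset.sum_range_add,
      Finset.sum_eq_zero (s := Finset.range n₁), add_zero]
    · refine sum_ge_of_sub_le (D := fun i => H i - (e₀ * ((i : ℤ) + 1) - e₁)) (fun n => ?_)
        (hzero _ (by push_cast; omega))
      have := hjump n
      push_cast
      linarith
    · intro i _
      exact hzero _ (by push_cast; omega)
  -- For negative `s` no deviation occurs at `n ≥ 0`, so `E = 0`; the binomial also vanishes, its
  -- upper entry `s + 2` being `0` or `1`.
  · rw [hE n₁ le_rfl, Finset.sum_eq_zero fun i _ => hzero i (by omega)]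
    have : s = -2 ∨ s = -1 := by omega
    have h1 : Ring.choose (1 : ℤ) 2 = 0 := by
      simpa using Ring.choose_natCast (R := ℤ) 1 2
    rcases this with rfl | rfl <;> simp [h1]

/-! ### Hilbert data in dimension two, and the main theorem. -/

namespace HilbertFiltration

variable {R : Type*} [CommRing R] {M : Type*} [AddCommGroup M] [Module R M] {q : Ideal R}

/-- The Hilbert data of a filtration on a two-dimensional module with eventually linear Hilbert
function. -/
theorem hilbertData_of_eventually_linear {F : q.Filtration M} (hdim : dimNat R M = 2) {e₀ e₁ : ℤ}
    {n₀ : ℕ} (hH : ∀ n ≥ n₀, (hilbertFunction F n : ℤ) = e₀ * (n + 1) - e₁) (he : e₀ ≠ 0) :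
    (∃ h : ℤ[X], IsHPolynomial F h) ∧ hilbertCoeff F 0 = e₀ ∧ hilbertCoeff F 1 = e₁ ∧
      ∃ n₁, ∀ n ≥ n₁, hilbertCoeff F 2 =
        ∑ i ∈ Finset.range n, ((hilbertFunction F i : ℤ) - (e₀ * (i + 1) - e₁)) := by
  have hex : ∃ h : ℤ[X], IsHPolynomial F h := by
    obtain ⟨h, hh⟩ := PowerSeries.exists_polynomial_of_eventually_linear hH
    refine ⟨h, by rw [hdim]; exact hh, ?_⟩
    rw [(PowerSeries.hasseDeriv_eval_of_eventually_linear hH hh).1]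
    exact he
  have hp : IsHPolynomial F (hPolynomial F) := by
    rw [hPolynomial, dif_pos hex]
    exact hex.choose_spec
  have hp1 := hp.1
  rw [hdim] at hp1
  exact ⟨hex, (PowerSeries.hasseDeriv_eval_of_eventually_linear hH hp1).2⟩

theorem hilbertPolynomialVal_eq_of_dimNat_eq_two (F : q.Filtration M) (hdim : dimNat R M = 2)
    (n : ℤ) :
    hilbertPolynomialVal F n = hilbertCoeff F 0 * (n + 1) - hilbertCoeff F 1 := by
  rw [hilbertPolynomialVal, hdim, Finset.sum_range_succ, Finset.sum_range_one]
  simp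
  ring

end HilbertFiltration

open HilbertFiltration

theorem theorem3 {R : Type*} [CommRing R] [IsNoetherianRing R] [IsLocalRing R]
    {M : Type*} [AddCommGroup M] [Module R M] [Module.Finite R M]
    (hdim : Module.supportDim R M = 2) (hdepth : 0 < HilbertFiltration.depth R M)
    (q : Ideal R) (hq : q.IsPrimary) (hqm : q.radical = IsLocalRing.maximalIdeal R)
    (F : q.Filtration M) (hF : HilbertFiltration.IsGood F)
    (a₁ a₂ : R) (ha : HilbertFiltration.IsMaximalSuperficialSeq F [a₁, a₂]) :
    (∃ h : ℤ[X], HilbertFiltration.IsHPolynomial F h) ∧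
    (∃ h : ℤ[X], HilbertFiltration.IsHPolynomial (HilbertFiltration.ratliffRush F) h) ∧
    HilbertFiltration.lengthQuot
      (HilbertFiltration.colonElem (a₁ • (⊤ : Submodule R M)) a₂) (a₁ • ⊤) ≠ ⊤ ∧
    ∃ s : ℤ, HilbertFiltration.IsPostulationNumber (HilbertFiltration.ratliffRush F) s ∧
      HilbertFiltration.hilbertCoeff F 2 ≥
        -(Ring.choose (s + 2) 2 *
          ((HilbertFiltration.lengthQuot
            (HilbertFiltration.colonElem (a₁ • (⊤ : Submodule R M)) a₂)
            (a₁ • ⊤)).toNat : ℤ)) := by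
  have hqle : q ≤ IsLocalRing.maximalIdeal R := hqm ▸ Ideal.le_radical
  have hqtop : q ≠ ⊤ := fun h => Ideal.IsPrime.ne_top' (top_le_iff.mp (h ▸ hqle))
  have hd2 : dimNat R M = 2 := by rw [dimNat, hdim]; rfl
  have ha₁ : IsSuperficial F a₁ :=
    (ha.1 0 (by simp)).of_quotFiltration_bot (by simp)
  have ha₂ : IsSuperficial (quotFiltration F (a₁ • (⊤ : Submodule R M))) a₂ := by
    have h := ha.1 1 (by simp)
    have h1 : Ideal.ofList ([a₁, a₂].take 1) • (⊤ : Submodule R M) = a₁ • ⊤ := by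
      simp [Submodule.ideal_span_singleton_smul]
    rwa [h1] at h
  have hreg := ha₁.isSMulRegular hF hqm hdepth
  have hker : LinearMap.ker (LinearMap.lsmul R M a₁) = ⊥ := LinearMap.ker_eq_bot.mpr hreg
  obtain ⟨c, hc⟩ := ha₁.exists_colonElem_eq hF
  simp only [hker, sup_bot_eq] at hc
  set P := a₁ • (⊤ : Submodule R M) with hP
  -- Both bounds matter: the upper one for the growth formula on `M / a₁M`, the lower one for `e₀ ≠
  -- 0`.
  have hdimN : Module.supportDim R (M ⧸ P) ≤ 1 ∧ ¬ Module.supportDim R (M ⧸ P) ≤ 0 := by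
    have h := Module.supportDim_quotSMulTop_succ_eq_supportDim hreg (hqle ha₁.1)
    rw [hdim, show (2 : WithBot ℕ∞) = 1 + 1 from rfl] at h
    refine ⟨withBot_enat_add_one_le_iff.mp h.le, fun h0 => ?_⟩
    have h1 := withBot_enat_add_one_le_iff.mp (h.ge.trans (add_le_add_left h0 1))
    exact absurd h1 (by decide)
  have hG := hF.quotFiltration P
  obtain ⟨hu, hl, n₀, hn₀⟩ := ha₂.exists_colength_succ_add_eq hG hqm hdimN.1
  set Ft := ratliffRush F with hFt
  have hFt0 : Ft.N 0 = ⊤ := top_le_iff.mp (hF.zero ▸ le_ratliffRush F 0)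
  have hFtc : ∀ n ≥ c, Ft.N n = F.N n := fun n hn => ratliffRush_eq_of_colonElem_eq ha₁.1 hc hn
  have hGt0 : (quotFiltration Ft P).N 0 = ⊤ := by
    change (Ft.N 0).map P.mkQ = ⊤
    rw [hFt0, Submodule.map_top, Submodule.range_mkQ]
  have hfinF := IsGood.length_quotient_ne_top hF.zero hqm
  have hfinFt := IsGood.length_quotient_ne_top hFt0 hqm
  have hfinG := IsGood.length_quotient_ne_top hG.zero hqm
  have hfinGt := IsGood.length_quotient_ne_top hGt0 hqm
  set K := LinearMap.ker (LinearMap.lsmul R (M ⧸ P) a₂)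
  rw [lengthQuot_colonElem_eq_length_ker P a₂]
  set l : ℕ := (Module.length R K).toNat
  set u : ℕ := colength (a₂ • (⊤ : Submodule R (M ⧸ P)))
  set g : ℕ → ℕ := fun n => colength ((quotFiltration Ft P).N n)
  have hgc : ∀ n ≥ c, (quotFiltration Ft P).N n = (quotFiltration F P).N n := fun n hn =>
    congrArg (Submodule.map P.mkQ) (hFtc n hn)
  have hg : ∀ n ≥ n₀ + c, g (n + 1) + l = g n + u := by
    intro n hn
    simp only [g]
    rw [hgc _ (by omega), hgc _ (by omega)]
    exact hn₀ n (by omega)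
  have hgjump : ∀ n, g (n + 1) ≤ g n + u := colength_succ_le ha₂.1 hfinGt hu
  -- Since `(Ft_{n+1} : a₁) = Ft_n`, the colon sequence for `a₁` cancels the colength of `Ft_n` and
  -- leaves that of `Ft_{n+1} + a₁M`; hence the index shift.
  have hHt : ∀ n, (hilbertFunction Ft n : ℤ) = g (n + 1) := by
    intro n
    rw [natCast_hilbertFunction hfinFt, colength_eq_colonElem_add (hfinFt (n + 1)) a₁,
      colonElem_ratliffRush ha₁.1 hc]
    push_cast
    rw [add_sub_cancel_left]
    simp only [g, colength]
    rw [← length_quotient_map_mkQ]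
    rfl
  have hHF : ∀ n ≥ c, (hilbertFunction F n : ℤ) = hilbertFunction Ft n := by
    intro n hn
    rw [natCast_hilbertFunction hfinF, natCast_hilbertFunction hfinFt, hFtc _ hn,
      hFtc _ (by omega)]
  set e₀ : ℤ := u - l
  obtain ⟨e₁, he₁⟩ : ∃ e₁ : ℤ, ∀ n ≥ n₀ + c, (g (n + 1) : ℤ) = e₀ * (n + 1) - e₁ := by
    refine ⟨e₀ * ((n₀ + c : ℕ) + 1) - g (n₀ + c + 1), fun n hn => ?_⟩
    induction n, hn using Nat.le_induction with
    | base => ring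
    | succ n hn ih =>
      have := hg (n + 1) (by omega)
      push_cast
      push_cast at ih
      simp only [e₀] at *
      zify at this
      linarith
  -- If `u = l`, the filtration on `M / a₁M` is eventually constant, hence zero by Krull. Then `M /
  -- a₁M` has finite length, contradicting its positive dimension.
  have he : e₀ ≠ 0 := by
    intro he
    have hconst : ∀ n ≥ n₀ + c, (quotFiltration F P).N n = (quotFiltration F P).N (n₀ + c) := by
      intro n hn
      induction n, hn using Nat.le_induction with
      | base => rfl
      | succ n hn ih =>
        rw [← ih]
        refine (eq_of_colength_eq ((quotFiltration F P).mono n) (hfinG _) ?_).symm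
        have := hn₀ n (by omega)
        change colength ((quotFiltration F P).N (n + 1)) + l =
          colength ((quotFiltration F P).N n) + u at this
        omega
    have hbot : (quotFiltration F P).N (n₀ + c) = ⊥ := by
      rw [eq_bot_iff]
      intro x hx
      exact hG.iInf_eq_bot hqtop (n₀ + c) fun n hn => (hconst n hn).symm ▸ hx
    refine hdimN.2 (supportDim_le_zero_of_isFiniteLength ?_)
    rw [← Module.length_ne_top_iff, ← (Submodule.quotEquivOfEqBot _ hbot).length_eq]
    exact hfinG _
  have hlinFt : ∀ n ≥ n₀ + c, (hilbertFunction Ft n : ℤ) = e₀ * (n + 1) - e₁ :=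
    fun n hn => (hHt n).trans (he₁ n hn)
  have hlinF : ∀ n ≥ n₀ + c, (hilbertFunction F n : ℤ) = e₀ * (n + 1) - e₁ :=
    fun n hn => (hHF n (by omega)).trans (hlinFt n hn)
  obtain ⟨hexF, -, -, n₁, hE⟩ := hilbertData_of_eventually_linear hd2 hlinF he
  obtain ⟨hexFt, hc0, hc1, -⟩ := hilbertData_of_eventually_linear hd2 hlinFt he
  obtain ⟨s, hs, hsE⟩ := exists_isGreatest_ne_of_eventually_linear (l := l) hlinFt he (by
    intro n
    rw [hHt, hHt]
    have := hgjump (n + 1)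
    simp only [e₀]
    omega)
  refine ⟨hexF, hexFt, hl, s, ?_, ?_⟩
  · rw [IsPostulationNumber]
    simp_rw [hilbertPolynomialVal_eq_of_dimNat_eq_two Ft hd2, hc0, hc1]
    exact hs
  -- `e₂` of `F` is also the total deviation of `Ft`: both have the same Hilbert polynomial, and for
  -- `n ≥ c` the partial sums are colengths of the same submodule `F_n = Ft_n`.
  · refine hsE _ (n₁ + c) fun n hn => ?_
    rw [hE n (by omega)]
    simp only [Finset.sum_sub_distrib]
    rw [sum_hilbertFunction hF.zero hfinF, sum_hilbertFunction hFt0 hfinFt, hFtc n (by omega)]
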